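/- Let $d\ge 1$, let $\Omega\subset\mathbb R^d$ be a bounded open set with $C^2$ boundary, let $\rho\in C_c^\infty(\Omega)$ with $\rho\ge 0$, and let $f:L^2(\Omega)\to L^2(\Omega)$ be continuous. Call $f$ strictly monotone if $\int_\Omega (f(m_1)-f(m_2))(m_1-m_2)>0$ for all $m_1\neq m_2$ in $L^2(\Omega)$. A pair $(u,m)\in (H^1_0(\Omega)\cap H^2(\Omega))\times H^1_0(\Omega)$ with $m\ge 0$ a.e. in $\Omega$ is called a mixed solution of (SOSMFG) if 1. $\max(-\Delta u+u-f(m),\,u)=0$ a.e. in $\Omega$; 2. $-\Delta m+m=\rho$ on $\{u<0\}$; 3. $-\Delta m+m\le\rho$ in $\mathcal D'(\Omega)$; 4. $\int_{\{u=0\}} f(m)\,m=0$. Here condition 2 means that $\int_\Omega \nabla m\cdot\nabla\varphi+m\varphi=\int_\Omega\rho\varphi$ for every $\varphi\in H^1_0(\Omega)$ for which there is $\varepsilon>0$ such that $\varphi=0$ a.e. on $\{u>-\varepsilon\}$. (If $u\in C(\overline\Omega)$, in particular if $d\le 3$, this is the equation in the sense of distributions on the open set $\{u<0\}$.) **Theorem.**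 If $f$ is strictly monotone, then there exists at most one mixed solution of (SOSMFG): if $(u_1,m_1)$ and $(u_2,m_2)$ are mixed solutions, then $u_1=u_2$ and $m_1=m_2$ a.e. in $\Omega$. -/

import Mathlib

open MeasureTheory TopologicalSpace
open scoped Laplacian Distributions

noncomputable section

namespace MixedMFG

/-- The Euclidean space `ℝ^d`. -/
abbrev Space (d : ℕ) := EuclideanSpace ℝ (Fin d)

variable {d : ℕ}

/-- The real space `L²(Ω)` (Lebesgue measure). -/
abbrev L2 (Ω : Opens (Space d)) := Lp ℝ 2 (volume.restrict (Ω : Set (Space d)))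

/-- The boundary of `Ω` is of class `C²`: near each of its points, `Ω` is the set where a `C²`
function with nowhere vanishing derivative is negative. -/
def HasC2Boundary (Ω : Opens (Space d)) : Prop :=
  ∀ x ∈ frontier (Ω : Set (Space d)), ∃ U : Set (Space d), IsOpen U ∧ x ∈ U ∧
    ∃ g : Space d → ℝ, ContDiffOn ℝ 2 g U ∧ (∀ y ∈ U, fderiv ℝ g y ≠ 0) ∧
      (Ω : Set (Space d)) ∩ U = {y ∈ U | g y < 0}

/-- The classical partial derivative `∂φ/∂x_i`. -/
def partialDeriv (i : Fin d) (φ : Space d → ℝ) (x : Space d) : ℝ :=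
  fderiv ℝ φ x (EuclideanSpace.single i 1)

/-- `g ∈ L²(Ω)` is the weak partial derivative `∂u/∂x_i` of `u ∈ L²(Ω)` on `Ω`. -/
def HasWeakPartial {Ω : Opens (Space d)} (i : Fin d) (u g : L2 Ω) : Prop :=
  ∀ φ : 𝓓(Ω, ℝ), ∫ x in (Ω : Set (Space d)), u x * partialDeriv i φ x
    = - ∫ x in (Ω : Set (Space d)), g x * φ x

/-- `G` is the weak gradient of `u` on `Ω`; thus `u ∈ H¹(Ω)` iff such a `G` exists. -/
def HasWeakGradient {Ω : Opens (Space d)} (u : L2 Ω) (G : Fin d → L2 Ω) : Prop :=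
  ∀ i, HasWeakPartial i u (G i)

/-- `u ∈ H²(Ω)`: the weak derivatives of order one and two exist in `L²(Ω)`. -/
def MemH2 {Ω : Opens (Space d)} (u : L2 Ω) : Prop :=
  ∃ G : Fin d → L2 Ω, HasWeakGradient u G ∧
    ∃ H : Fin d → Fin d → L2 Ω, ∀ i, HasWeakGradient (G i) (H i)

/-- `u ∈ H¹₀(Ω)`: `u ∈ H¹(Ω)` is a limit, in the norm of `H¹(Ω)`, of smooth functions with compact
support in `Ω`. -/
def MemH10 {Ω : Opens (Space d)} (u : L2 Ω) : Prop :=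
  ∃ G : Fin d → L2 Ω, HasWeakGradient u G ∧ ∀ ε : ENNReal, 0 < ε → ∃ φ : 𝓓(Ω, ℝ),
    eLpNorm (fun x => φ x - u x) 2 (volume.restrict (Ω : Set (Space d))) < ε ∧
    ∀ i, eLpNorm (fun x => partialDeriv i φ x - G i x) 2
      (volume.restrict (Ω : Set (Space d))) < ε

/-- `w ∈ L²(Ω)` is the distributional Laplacian of `u ∈ L²(Ω)` on `Ω`. -/
def HasWeakLaplacian {Ω : Opens (Space d)} (u w : L2 Ω) : Prop :=
  ∀ φ : 𝓓(Ω, ℝ), ∫ x in (Ω : Set (Space d)), u x * (Δ (φ : Space d → ℝ)) x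
    = ∫ x in (Ω : Set (Space d)), w x * φ x

/-- The obstacle problem `max(-Δu + u - h, u) = 0` almost everywhere in `Ω`. -/
def SolvesObstacle {Ω : Opens (Space d)} (u h : L2 Ω) : Prop :=
  ∃ w : L2 Ω, HasWeakLaplacian u w ∧
    ∀ᵐ x ∂(volume.restrict (Ω : Set (Space d))), max (-(w x) + u x - h x) (u x) = 0

/-- `-Δm + m ≤ ρ` in the sense of distributions on `Ω`. -/
def IsSubsolution {Ω : Opens (Space d)} (ρ : 𝓓(Ω, ℝ)) (m : L2 Ω) : Prop :=
  ∀ φ : 𝓓(Ω, ℝ), (∀ x, 0 ≤ φ x) →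
    ∫ x in (Ω : Set (Space d)), m x * (-(Δ (φ : Space d → ℝ)) x + φ x)
      ≤ ∫ x in (Ω : Set (Space d)), ρ x * φ x

/-- `-Δm + m = ρ` on `{u < 0}`, for `m ∈ H¹(Ω)` and `u ∈ H¹₀(Ω) ∩ H²(Ω)`.

The test functions supported in `{u < 0}` are the `φ ∈ H¹₀(Ω)` that vanish a.e. outside
`{u ≤ -ε}` for some `ε > 0`. If `u` is continuous on the closure of `Ω` and vanishes on the
boundary, then `{u < 0}` is open, this class contains `C_c^∞({u < 0})`, and each of its members is
an `H¹`-limit of functions of `C_c^∞({u < 0})`; so this is exactly the equation in the sense of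
distributions on the open set `{u < 0}`. The formulation still makes sense when `u` has no
continuous representative (which happens only for `d ≥ 4`). -/
def SolvesOnNegativeSet {Ω : Opens (Space d)} (ρ : 𝓓(Ω, ℝ)) (u m : L2 Ω) : Prop :=
  ∀ (φ : L2 Ω) (Gφ Gm : Fin d → L2 Ω), MemH10 φ → HasWeakGradient φ Gφ → HasWeakGradient m Gm →
    (∃ ε : ℝ, 0 < ε ∧
      ∀ᵐ x ∂(volume.restrict (Ω : Set (Space d))), -ε < u x → φ x = 0) →
    ∫ x in (Ω : Set (Space d)), ((∑ i, Gm i x * Gφ i x) + m x * φ x)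
      = ∫ x in (Ω : Set (Space d)), ρ x * φ x

/-- `(u, m)` is a mixed solution of the stationary optimal stopping mean field game with running
cost `f` and source of players `ρ`. -/
structure IsMixedSolution {Ω : Opens (Space d)} (f : L2 Ω → L2 Ω) (ρ : 𝓓(Ω, ℝ)) (u m : L2 Ω) :
    Prop where
  u_memH10 : MemH10 u
  u_memH2 : MemH2 u
  m_memH10 : MemH10 m
  /-- `m` is a density of players. -/
  m_nonneg : ∀ᵐ x ∂(volume.restrict (Ω : Set (Space d))), 0 ≤ m x
  obstacle : SolvesObstacle u (f m)
  eq_on_neg : SolvesOnNegativeSet ρ u m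
  subsolution : IsSubsolution ρ m
  contact : ∫ x in {x ∈ (Ω : Set (Space d)) | u x = 0}, f m x * m x = 0

/-- `f : L²(Ω) → L²(Ω)` is strictly monotone. -/
def StrictlyMonotone {Ω : Opens (Space d)} (f : L2 Ω → L2 Ω) : Prop :=
  ∀ m₁ m₂ : L2 Ω, m₁ ≠ m₂ →
    0 < ∫ x in (Ω : Set (Space d)), (f m₁ x - f m₂ x) * (m₁ x - m₂ x)

end MixedMFG

end

/-! Uniqueness is the Lasry–Lions monotonicity argument. For mixed solutions (u, m) and (u', m') one
shows ∫ f(m) m ≤ ∫ ρ u ≤ ∫ f(m) m'. Writing both inequalities for each of the two solutions and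
adding, ∫ (f(m₁) - f(m₂))(m₁ - m₂) ≤ 0, so m₁ = m₂ by strict monotonicity. Then u₁ and u₂ solve the
same obstacle problem, whose solution is unique by an energy estimate (`SolvesObstacle.unique`).

Upper bound on ρ (`IsMixedSolution.le_integral_cost`): since -Δu + u ≤ f(m) and m' ≥ 0, Green's
formula bounds ∫ ∇u·∇m' + u m' by ∫ f(m) m'. As u ≤ 0, the subsolution inequality for m' tested with
u gives ∫ ρ u ≤ ∫ ∇u·∇m' + u m'.

Lower bound (`IsMixedSolution.integral_cost_le`): on {u < 0} the obstacle equation is an equality,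
and the equation for m tested with u is an equality too. On {u = 0} the integral of f(m) m vanishes,
and what remains is ∫_{u=0} Δu m, which only has to be nonpositive
(`HasWeakLaplacian.integral_contact_nonpos`).

Testing with u is justified by truncation (`ApproxBy.exists_truncation`): smooth functions of u that
vanish where u is near 0 converge to u in H¹. They are admissible in the equation on {u < 0} and are
limits of nonpositive test functions. -/

namespace MixedMFG

open Filter Topology ContDiff

/-! ### Convergence in L² and products with bounded sequences -/

section L2Convergence

variable {α : Type*} [MeasurableSpace α] {μ : Measure α}

/-- Convergence of a sequence of square integrable functions in the norm of `L²`. -/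
structure L2Tendsto (μ : Measure α) (g : ℕ → α → ℝ) (g₀ : α → ℝ) : Prop where
  memLp : ∀ n, MemLp (g n) 2 μ
  memLp_lim : MemLp g₀ 2 μ
  tendsto : Tendsto (fun n => eLpNorm (g n - g₀) 2 μ) atTop (𝓝 0)

theorem MemLp.integrable_mul_two {f g : α → ℝ} (hf : MemLp f 2 μ) (hg : MemLp g 2 μ) :
    Integrable (fun x => f x * g x) μ :=
  MeasureTheory.MemLp.integrable_mul hf hg

theorem L2Tendsto.neg {g : ℕ → α → ℝ} {g₀ : α → ℝ} (h : L2Tendsto μ g g₀) :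
    L2Tendsto μ (fun n => -g n) (-g₀) := by
  refine ⟨fun n => (h.memLp n).neg, h.memLp_lim.neg, ?_⟩
  refine h.tendsto.congr fun n => ?_
  rw [← eLpNorm_neg]
  congr 1
  abel

theorem L2Tendsto.congr {g g' : ℕ → α → ℝ} {g₀ g₀' : α → ℝ} (h : L2Tendsto μ g g₀)
    (hg : ∀ n, g n =ᵐ[μ] g' n) (hg₀ : g₀ =ᵐ[μ] g₀') : L2Tendsto μ g' g₀' :=
  ⟨fun n => (memLp_congr_ae (hg n)).1 (h.memLp n), (memLp_congr_ae hg₀).1 h.memLp_lim,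
    h.tendsto.congr fun n => eLpNorm_congr_ae ((hg n).sub hg₀)⟩

/-- Strong convergence in `L²` implies convergence of the integrals against a fixed function. -/
theorem L2Tendsto.integral_mul {g : ℕ → α → ℝ} {g₀ h : α → ℝ} (hg : L2Tendsto μ g g₀)
    (hh : MemLp h 2 μ) :
    Tendsto (fun n => ∫ x, h x * g n x ∂μ) atTop (𝓝 (∫ x, h x * g₀ x ∂μ)) := by
  have key : Tendsto (fun n => (hg.memLp n).toLp (g n)) atTop (𝓝 (hg.memLp_lim.toLp g₀)) :=
    (Lp.tendsto_Lp_iff_tendsto_eLpNorm'' _ _ _ _).2 hg.tendsto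
  have h1 := (tendsto_const_nhds (x := hh.toLp h)).inner (𝕜 := ℝ) key
  have aux : ∀ {g : α → ℝ} (hg : MemLp g 2 μ),
      inner ℝ (hh.toLp h) (hg.toLp g) = ∫ x, h x * g x ∂μ := by
    intro g hg
    rw [L2.inner_def]
    refine integral_congr_ae ?_
    filter_upwards [hh.coeFn_toLp, hg.coeFn_toLp] with x h1 h2
    rw [h1, h2]
    simp [mul_comm]
  simpa only [aux] using h1

theorem memLp_bdd_mul {b g : α → ℝ} {C : ℝ} (hb : AEStronglyMeasurable b μ)
    (hC : ∀ᵐ x ∂μ, |b x| ≤ C) (hg : MemLp g 2 μ) : MemLp (fun x => b x * g x) 2 μ := by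
  refine MemLp.of_le_mul (c := C) hg (hb.mul hg.1) ?_
  filter_upwards [hC] with x hx
  rw [norm_mul]
  exact mul_le_mul_of_nonneg_right hx (norm_nonneg _)

/-- Dominated convergence in `L²` for products with a bounded sequence converging a.e. -/
theorem L2Tendsto.bdd_mul_const {b : ℕ → α → ℝ} {b₀ g : α → ℝ} {C : ℝ}
    (hb : ∀ n, AEStronglyMeasurable (b n) μ) (hC : ∀ n, ∀ᵐ x ∂μ, |b n x| ≤ C)
    (hb₀ : ∀ᵐ x ∂μ, Tendsto (fun n => b n x) atTop (𝓝 (b₀ x))) (hg : MemLp g 2 μ) :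
    L2Tendsto μ (fun n x => b n x * g x) (fun x => b₀ x * g x) := by
  have hb₀m : AEStronglyMeasurable b₀ μ := aestronglyMeasurable_of_tendsto_ae _ hb hb₀
  have hall : ∀ᵐ x ∂μ, ∀ n, |b n x| ≤ C := ae_all_iff.2 hC
  have hC₀ : ∀ᵐ x ∂μ, |b₀ x| ≤ C := by
    filter_upwards [hall, hb₀] with x h1 h2
    exact le_of_tendsto h2.abs (Eventually.of_forall h1)
  have m1 := fun n => memLp_bdd_mul (hb n) (hC n) hg
  have m2 := memLp_bdd_mul hb₀m hC₀ hg
  refine ⟨m1, m2, ?_⟩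
  have hsq : ∀ n, eLpNorm ((fun x => b n x * g x) - fun x => b₀ x * g x) 2 μ
      = ENNReal.ofReal (∫ x, (b n x * g x - b₀ x * g x) ^ 2 ∂μ) ^ (1 / 2 : ℝ) := by
    intro n
    have := ((m1 n).sub m2).eLpNorm_eq_integral_rpow_norm (by norm_num) (by norm_num)
    rw [this, ENNReal.ofReal_rpow_of_nonneg (by positivity) (by norm_num)]
    simp
  simp_rw [hsq]
  have hlim : Tendsto (fun n => ∫ x, (b n x * g x - b₀ x * g x) ^ 2 ∂μ) atTop
      (𝓝 (∫ _, (0 : ℝ) ∂μ)) := by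
    -- Both b n and its limit are bounded by C, so their difference is at most 2C; this gives the
    -- dominating function.
    refine tendsto_integral_of_dominated_convergence (fun x => (2 * C) ^ 2 * g x ^ 2)
      (fun n => (((m1 n).sub m2).1.pow 2)) (hg.integrable_sq.const_mul _) (fun n => ?_) ?_
    · filter_upwards [hall, hC₀] with x h1 h2
      have h3 : |b n x - b₀ x| ≤ 2 * C := by
        have := abs_sub (b n x) (b₀ x)
        have := h1 n
        linarith
      rw [← sub_mul, mul_pow, Real.norm_of_nonneg (by positivity)]
      exact mul_le_mul_of_nonneg_right (sq_le_sq' (by linarith [neg_abs_le (b n x - b₀ x)])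
        ((le_abs_self _).trans h3)) (sq_nonneg _)
    · filter_upwards [hb₀] with x h
      have := ((h.mul_const (g x)).sub_const (b₀ x * g x)).pow 2
      simpa using this
  rw [integral_zero] at hlim
  have := (ENNReal.tendsto_ofReal hlim)
  have h2 := this.ennrpow_const (1 / 2 : ℝ)
  simpa using h2

theorem L2Tendsto.trans {f g : ℕ → α → ℝ} {g₀ : α → ℝ} (hf : ∀ n, MemLp (f n) 2 μ)
    (hfg : Tendsto (fun n => eLpNorm (f n - g n) 2 μ) atTop (𝓝 0)) (hg : L2Tendsto μ g g₀) :
    L2Tendsto μ f g₀ := by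
  refine ⟨hf, hg.memLp_lim, ?_⟩
  have h := hfg.add hg.tendsto
  rw [add_zero] at h
  refine tendsto_of_tendsto_of_tendsto_of_le_of_le tendsto_const_nhds h (fun _ => zero_le) ?_
  intro n
  have := eLpNorm_add_le (((hf n).sub (hg.memLp n)).1) (((hg.memLp n).sub hg.memLp_lim).1)
    (p := 2) (by norm_num)
  simpa using this

/-- In `L²`, the product of a bounded sequence that converges a.e. and a convergent sequence
converges. -/
theorem L2Tendsto.bdd_mul {b g : ℕ → α → ℝ} {b₀ g₀ : α → ℝ} {C : ℝ}
    (hb : ∀ n, AEStronglyMeasurable (b n) μ) (hC : ∀ n, ∀ᵐ x ∂μ, |b n x| ≤ C)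
    (hb₀ : ∀ᵐ x ∂μ, Tendsto (fun n => b n x) atTop (𝓝 (b₀ x))) (hg : L2Tendsto μ g g₀) :
    L2Tendsto μ (fun n x => b n x * g n x) (fun x => b₀ x * g₀ x) := by
  -- Splitting: b n g n - b₀ g₀ = b n (g n - g₀) + (b n - b₀) g₀. The first term is controlled by C,
  -- the second by dominated convergence.
  refine L2Tendsto.trans (fun n => memLp_bdd_mul (hb n) (hC n) (hg.memLp n)) ?_
    (L2Tendsto.bdd_mul_const hb hC hb₀ hg.memLp_lim)
  have h := ENNReal.Tendsto.const_mul (a := ENNReal.ofReal C) hg.tendsto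
    (Or.inr ENNReal.ofReal_ne_top)
  rw [mul_zero] at h
  refine tendsto_of_tendsto_of_tendsto_of_le_of_le tendsto_const_nhds h (fun _ => zero_le) ?_
  intro n
  refine eLpNorm_le_mul_eLpNorm_of_ae_le_mul ?_ 2
  filter_upwards [hC n] with x hx
  simp only [Pi.sub_apply]
  rw [← mul_sub, norm_mul]
  exact mul_le_mul_of_nonneg_right hx (norm_nonneg _)

theorem L2Tendsto.comp_lipschitz {g : ℕ → α → ℝ} {g₀ : α → ℝ} {F : ℝ → ℝ} {C : ℝ}
    (hF : Continuous F) (hF0 : F 0 = 0) (hC : ∀ s t, |F s - F t| ≤ C * |s - t|)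
    (hg : L2Tendsto μ g g₀) : L2Tendsto μ (fun n x => F (g n x)) (fun x => F (g₀ x)) := by
  have hm : ∀ {g : α → ℝ}, MemLp g 2 μ → MemLp (fun x => F (g x)) 2 μ := by
    intro g hg
    refine MemLp.of_le_mul (c := C) hg (hF.comp_aestronglyMeasurable hg.1)
      (Eventually.of_forall fun x => ?_)
    simpa [hF0] using hC (g x) 0
  refine ⟨fun n => hm (hg.memLp n), hm hg.memLp_lim, ?_⟩
  have h := ENNReal.Tendsto.const_mul (a := ENNReal.ofReal C) hg.tendsto
    (Or.inr ENNReal.ofReal_ne_top)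
  rw [mul_zero] at h
  refine tendsto_of_tendsto_of_tendsto_of_le_of_le tendsto_const_nhds h (fun _ => zero_le) ?_
  intro n
  exact eLpNorm_le_mul_eLpNorm_of_ae_le_mul (Eventually.of_forall fun x => hC _ _) 2

theorem L2Tendsto.add {f g : ℕ → α → ℝ} {f₀ g₀ : α → ℝ} (hf : L2Tendsto μ f f₀)
    (hg : L2Tendsto μ g g₀) : L2Tendsto μ (fun n x => f n x + g n x) (fun x => f₀ x + g₀ x) := by
  refine ⟨fun n => (hf.memLp n).add (hg.memLp n), hf.memLp_lim.add hg.memLp_lim, ?_⟩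
  have h := hf.tendsto.add hg.tendsto
  rw [add_zero] at h
  refine tendsto_of_tendsto_of_tendsto_of_le_of_le tendsto_const_nhds h (fun _ => zero_le) ?_
  intro n
  have e : ((fun x => f n x + g n x) - fun x => f₀ x + g₀ x) = (f n - f₀) + (g n - g₀) :=
    add_sub_add_comm (f n) (g n) f₀ g₀
  dsimp only
  rw [e]
  exact eLpNorm_add_le ((hf.memLp n).sub hf.memLp_lim).1 ((hg.memLp n).sub hg.memLp_lim).1
    (by norm_num)

end L2Convergence

/-! ### Calculus of test functions and the fundamental lemma -/

section TestFunctions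

variable {d : ℕ} {Ω : Opens (Space d)}

theorem memLp_test (φ : 𝓓(Ω, ℝ)) : MemLp φ 2 (volume.restrict (Ω : Set (Space d))) :=
  (φ.continuous.memLp_of_hasCompactSupport φ.hasCompactSupport).restrict _

/-- The partial derivative of a test function, as a test function. -/
noncomputable def testPartial (i : Fin d) (φ : 𝓓(Ω, ℝ)) :
    𝓓(Ω, ℝ) where
  toFun := partialDeriv i φ
  contDiff' := (φ.contDiff.fderiv_right (m := ∞) (by simp)).clm_apply contDiff_const
  hasCompactSupport' := φ.hasCompactSupport.fderiv_apply (𝕜 := ℝ) _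
  tsupport_subset' := (tsupport_fderiv_apply_subset ℝ _).trans φ.tsupport_subset

@[simp]
theorem coe_testPartial (i : Fin d) (φ : 𝓓(Ω, ℝ)) :
    (testPartial i φ : Space d → ℝ) = partialDeriv i φ := rfl

/-- The composition of a smooth function vanishing at `0` with a test function. -/
noncomputable def testComp (F : ℝ → ℝ) (hF : ContDiff ℝ ∞ F) (hF0 : F 0 = 0) (φ : 𝓓(Ω, ℝ)) :
    𝓓(Ω, ℝ) where
  toFun := F ∘ φ
  contDiff' := hF.comp φ.contDiff
  hasCompactSupport' := φ.hasCompactSupport.comp_left hF0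
  tsupport_subset' := (tsupport_comp_subset hF0 _).trans φ.tsupport_subset

/-- The product of a smooth function of a test function and a test function. -/
noncomputable def testCompMul (F : ℝ → ℝ) (hF : ContDiff ℝ ∞ F) (φ ψ : 𝓓(Ω, ℝ)) : 𝓓(Ω, ℝ) where
  toFun x := F (φ x) * ψ x
  contDiff' := (hF.comp φ.contDiff).mul ψ.contDiff
  hasCompactSupport' := ψ.hasCompactSupport.mul_left
  tsupport_subset' := (tsupport_mul_subset_right).trans ψ.tsupport_subset

theorem differentiable_test (φ : 𝓓(Ω, ℝ)) : Differentiable ℝ φ :=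
  φ.contDiff.differentiable (by simp)

theorem partialDeriv_comp {F : ℝ → ℝ} (hF : Differentiable ℝ F) (φ : 𝓓(Ω, ℝ)) (i : Fin d)
    (x : Space d) : partialDeriv i (F ∘ φ) x = deriv F (φ x) * partialDeriv i φ x := by
  have h := (hF (φ x)).hasDerivAt.comp_hasFDerivAt x (differentiable_test φ x).hasFDerivAt
  simp [partialDeriv, h.fderiv]

theorem partialDeriv_testCompMul {F : ℝ → ℝ} (hF : ContDiff ℝ ∞ F) (φ ψ : 𝓓(Ω, ℝ)) (i : Fin d)
    (x : Space d) : partialDeriv i (testCompMul F hF φ ψ) x =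
      deriv F (φ x) * ψ x * partialDeriv i φ x + F (φ x) * partialDeriv i ψ x := by
  have h := (hF.differentiable (by simp) (φ x)).hasDerivAt.comp_hasFDerivAt x
    (differentiable_test φ x).hasFDerivAt
  have h2 := h.mul (differentiable_test ψ x).hasFDerivAt
  have h3 : HasFDerivAt (testCompMul F hF φ ψ) _ x := h2
  rw [partialDeriv, h3.fderiv]
  simp [partialDeriv]
  ring

theorem partialDeriv_neg_test (φ : 𝓓(Ω, ℝ)) (i : Fin d) :
    partialDeriv i (-φ : 𝓓(Ω, ℝ)) = -partialDeriv i φ := by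
  ext x
  have : ((-φ : 𝓓(Ω, ℝ)) : Space d → ℝ) = fun x => -φ x := rfl
  simp [partialDeriv, this]

/-- Test functions vanish off Ω, so integrations by parts can be done on the whole space, without
boundary terms. -/
theorem setIntegral_eq_integral_mul_test (g : Space d → ℝ) (φ : 𝓓(Ω, ℝ)) :
    ∫ x in (Ω : Set (Space d)), g x * φ x = ∫ x, g x * φ x := by
  refine setIntegral_eq_integral_of_forall_compl_eq_zero fun x hx => ?_
  rw [image_eq_zero_of_notMem_tsupport fun h => hx (φ.tsupport_subset h), mul_zero]

/-- Integration by parts for test functions. -/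
theorem integral_test_mul_partialDeriv (φ ψ : 𝓓(Ω, ℝ)) (i : Fin d) :
    ∫ x in (Ω : Set (Space d)), φ x * partialDeriv i ψ x
      = - ∫ x in (Ω : Set (Space d)), partialDeriv i φ x * ψ x := by
  have e1 := setIntegral_eq_integral_mul_test φ (testPartial i ψ)
  have e2 := setIntegral_eq_integral_mul_test (partialDeriv i φ) ψ
  rw [coe_testPartial] at e1
  rw [e1, e2]
  have hint : ∀ a b : 𝓓(Ω, ℝ), Integrable (fun x => a x * b x) := fun a b =>
    (a.continuous.mul b.continuous).integrable_of_hasCompactSupport b.hasCompactSupport.mul_left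
  exact integral_mul_fderiv_eq_neg_fderiv_mul_of_integrable (hint (testPartial i φ) ψ)
    (hint φ (testPartial i ψ)) (hint φ ψ) (fun x _ => differentiable_test φ x)
    (fun x _ => differentiable_test ψ x)

theorem laplacian_test (φ : 𝓓(Ω, ℝ)) (x : Space d) :
    (Δ (φ : Space d → ℝ)) x = ∑ i, partialDeriv i (testPartial i φ) x := by
  rw [InnerProductSpace.laplacian_eq_iteratedFDeriv_orthonormalBasis (φ : Space d → ℝ)
    (EuclideanSpace.basisFun (Fin d) ℝ)]
  refine Finset.sum_congr rfl fun i _ => ?_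
  have hd : DifferentiableAt ℝ (fderiv ℝ φ) x :=
    (φ.contDiff.fderiv_right (m := ∞) (by simp)).differentiable (by simp) x
  have h := hd.hasFDerivAt.clm_apply
    (hasFDerivAt_const (EuclideanSpace.single i (1 : ℝ) : Space d) x)
  have h' : HasFDerivAt (testPartial i φ) _ x := h
  rw [iteratedFDeriv_two_apply]
  rw [partialDeriv, h'.fderiv]
  simp

/-- Square integrable functions with the same integrals against test functions are equal. -/
theorem ae_eq_of_integral_mul_test {g h : Space d → ℝ}
    (hg : MemLp g 2 (volume.restrict (Ω : Set (Space d))))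
    (hh : MemLp h 2 (volume.restrict (Ω : Set (Space d))))
    (heq : ∀ φ : 𝓓(Ω, ℝ), ∫ x in (Ω : Set (Space d)), g x * φ x
      = ∫ x in (Ω : Set (Space d)), h x * φ x) :
    g =ᵐ[volume.restrict (Ω : Set (Space d))] h := by
  have hsub := hg.sub hh
  have h1 : LocallyIntegrableOn (g - h) (Ω : Set (Space d)) volume := by
    have h2 := hsub.locallyIntegrable (by norm_num)
    exact (locallyIntegrableOn_of_locallyIntegrable_restrict h2)
  have key := IsOpen.ae_eq_zero_of_integral_contDiff_smul_eq_zero Ω.isOpen h1 (by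
    intro ψ hψ hc hs
    let φ : 𝓓(Ω, ℝ) := ⟨ψ, hψ, hc, hs⟩
    have e := heq φ
    have e1 := setIntegral_eq_integral_mul_test (g - h) φ
    have e2 : ∫ x, ψ x • (g - h) x = ∫ x, (g - h) x * φ x := by
      refine integral_congr_ae (Eventually.of_forall fun x => ?_)
      simp only [smul_eq_mul]
      exact mul_comm _ _
    rw [e2, ← e1]
    simp only [Pi.sub_apply, sub_mul]
    rw [integral_sub (MemLp.integrable_mul_two hg (memLp_test φ))
      (MemLp.integrable_mul_two hh (memLp_test φ)), e, sub_self])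
  rw [EventuallyEq, ae_restrict_iff' Ω.isOpen.measurableSet]
  filter_upwards [key] with x hx hxΩ
  exact sub_eq_zero.1 (hx hxΩ)

end TestFunctions

/-! ### Weak gradients, the chain rule in H¹₀ and Green's formula -/

section Sobolev

variable {d : ℕ} {Ω : Opens (Space d)}

/-- The test functions `φ n` converge to `u` in `H¹`, with gradients converging to `G`, and almost
everywhere. -/
structure ApproxBy (φ : ℕ → 𝓓(Ω, ℝ)) (u : L2 Ω) (G : Fin d → L2 Ω) : Prop where
  tendsto : L2Tendsto (volume.restrict (Ω : Set (Space d))) (fun n => φ n) u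
  tendsto_partial : ∀ i, L2Tendsto (volume.restrict (Ω : Set (Space d)))
    (fun n => partialDeriv i (φ n)) (G i)
  ae_tendsto : ∀ᵐ x ∂(volume.restrict (Ω : Set (Space d))),
    Tendsto (fun n => φ n x) atTop (𝓝 (u x))

theorem memLp_partialDeriv_test (φ : 𝓓(Ω, ℝ)) (i : Fin d) :
    MemLp (partialDeriv i φ) 2 (volume.restrict (Ω : Set (Space d))) :=
  memLp_test (testPartial i φ)

/-- Convergence in L² gives convergence in measure, hence a.e. along a subsequence. The a.e.
convergence is what allows nonlinear functions of the approximants to pass to the limit. -/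
theorem MemH10.exists_approxBy {u : L2 Ω} (hu : MemH10 u) :
    ∃ (G : Fin d → L2 Ω) (φ : ℕ → 𝓓(Ω, ℝ)), HasWeakGradient u G ∧ ApproxBy φ u G := by
  obtain ⟨G, hG, h⟩ := hu
  have hpos : ∀ n : ℕ, (0 : ENNReal) < ((n : ENNReal) + 1)⁻¹ := fun n =>
    ENNReal.inv_pos.2 (by finiteness)
  choose φ hφ hφ' using fun n : ℕ => h _ (hpos n)
  have h0 : Tendsto (fun n : ℕ => ((n : ENNReal) + 1)⁻¹) atTop (𝓝 0) := by
    have := (tendsto_add_atTop_iff_nat 1).2 ENNReal.tendsto_inv_nat_nhds_zero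
    simpa using this
  have t1 : Tendsto (fun n => eLpNorm ((φ n : Space d → ℝ) - (u : Space d → ℝ)) 2
      (volume.restrict (Ω : Set (Space d)))) atTop (𝓝 0) :=
    tendsto_of_tendsto_of_tendsto_of_le_of_le tendsto_const_nhds h0 (fun _ => zero_le)
      fun n => (hφ n).le
  have t2 : ∀ i, Tendsto (fun n => eLpNorm (partialDeriv i (φ n) - (G i : Space d → ℝ)) 2
      (volume.restrict (Ω : Set (Space d)))) atTop (𝓝 0) := fun i =>
    tendsto_of_tendsto_of_tendsto_of_le_of_le tendsto_const_nhds h0 (fun _ => zero_le)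
      fun n => (hφ' n i).le
  obtain ⟨ns, hns, hae⟩ := (tendstoInMeasure_of_tendsto_eLpNorm (by norm_num)
    (fun n => (memLp_test (φ n)).1) (Lp.memLp u).1 t1).exists_seq_tendsto_ae
  exact ⟨G, fun n => φ (ns n), hG,
    ⟨fun n => memLp_test _, Lp.memLp u, t1.comp hns.tendsto_atTop⟩,
    fun i => ⟨fun n => memLp_partialDeriv_test _ i, Lp.memLp (G i), (t2 i).comp hns.tendsto_atTop⟩,
    hae⟩

/-- Weak derivatives are stable under `L²` convergence. -/
theorem hasWeakPartial_of_tendsto {i : Fin d} {v g : ℕ → Space d → ℝ} {u w : L2 Ω}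
    (hv : L2Tendsto (volume.restrict (Ω : Set (Space d))) v u)
    (hg : L2Tendsto (volume.restrict (Ω : Set (Space d))) g w)
    (h : ∀ n (ψ : 𝓓(Ω, ℝ)), ∫ x in (Ω : Set (Space d)), v n x * partialDeriv i ψ x
      = - ∫ x in (Ω : Set (Space d)), g n x * ψ x) : HasWeakPartial i u w := by
  intro ψ
  have h1 := hv.integral_mul (memLp_partialDeriv_test ψ i)
  have h2 := (hg.integral_mul (memLp_test ψ)).neg
  simp only [mul_comm (partialDeriv i ψ _), mul_comm (ψ _)] at h1 h2
  exact tendsto_nhds_unique h1 (h2.congr fun n => (h n ψ).symm)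

theorem ApproxBy.hasWeakGradient {φ : ℕ → 𝓓(Ω, ℝ)} {u : L2 Ω} {G : Fin d → L2 Ω}
    (h : ApproxBy φ u G) : HasWeakGradient u G := fun i =>
  hasWeakPartial_of_tendsto h.tendsto (h.tendsto_partial i)
    fun n ψ => integral_test_mul_partialDeriv (φ n) ψ i

theorem ApproxBy.memH10 {φ : ℕ → 𝓓(Ω, ℝ)} {u : L2 Ω} {G : Fin d → L2 Ω}
    (h : ApproxBy φ u G) : MemH10 u := by
  refine ⟨G, h.hasWeakGradient, fun ε hε => ?_⟩
  have h1 := h.tendsto.tendsto.eventually (gt_mem_nhds hε)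
  have h2 := eventually_all.2 fun i => (h.tendsto_partial i).tendsto.eventually (gt_mem_nhds hε)
  obtain ⟨n, hn1, hn2⟩ := (h1.and h2).exists
  exact ⟨φ n, hn1, hn2⟩

theorem HasWeakPartial.ae_unique {i : Fin d} {u g g' : L2 Ω} (h : HasWeakPartial i u g)
    (h' : HasWeakPartial i u g') : g = g' :=
  Lp.ext (ae_eq_of_integral_mul_test (Lp.memLp g) (Lp.memLp g') fun φ => by
    have h1 := h φ
    rw [h' φ] at h1
    exact (neg_inj.1 h1).symm)

theorem ApproxBy.neg {φ : ℕ → 𝓓(Ω, ℝ)} {u : L2 Ω} {G : Fin d → L2 Ω}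
    (h : ApproxBy φ u G) : ApproxBy (fun n => -φ n) (-u) (fun i => -G i) := by
  refine ⟨h.tendsto.neg.congr (fun n => EventuallyEq.rfl) (Lp.coeFn_neg u).symm, fun i => ?_, ?_⟩
  · refine (h.tendsto_partial i).neg.congr (fun n => ?_) (Lp.coeFn_neg (G i)).symm
    rw [partialDeriv_neg_test]
  · filter_upwards [h.ae_tendsto, Lp.coeFn_neg u] with x h1 h2
    rw [h2]
    exact h1.neg

theorem abs_sub_le_of_abs_deriv_le {F : ℝ → ℝ} {C : ℝ} (hF : Differentiable ℝ F)
    (hC : ∀ s, |deriv F s| ≤ C) (s t : ℝ) : |F s - F t| ≤ C * |s - t| :=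
  Convex.norm_image_sub_le_of_norm_deriv_le (fun x _ => hF x) (fun x _ => hC x) convex_univ
    (Set.mem_univ t) (Set.mem_univ s)

/-- The chain rule in `H¹₀`. -/
theorem ApproxBy.comp {φ : ℕ → 𝓓(Ω, ℝ)} {u : L2 Ω} {G : Fin d → L2 Ω} (h : ApproxBy φ u G)
    {F : ℝ → ℝ} (hF : ContDiff ℝ ∞ F) (hF0 : F 0 = 0) {C : ℝ} (hC : ∀ s, |deriv F s| ≤ C) :
    ∃ (v : L2 Ω) (H : Fin d → L2 Ω), ApproxBy (fun n => testComp F hF hF0 (φ n)) v H ∧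
      v =ᵐ[volume.restrict (Ω : Set (Space d))] (fun x => F (u x)) ∧
      ∀ i, H i =ᵐ[volume.restrict (Ω : Set (Space d))] fun x => deriv F (u x) * G i x := by
  have hd : Differentiable ℝ F := hF.differentiable (by simp)
  have hdc : Continuous (deriv F) := hF.continuous_deriv (by simp)
  have t1 := h.tendsto.comp_lipschitz hF.continuous hF0 (abs_sub_le_of_abs_deriv_le hd hC)
  -- Here `deriv F (φ n)` is bounded and converges a.e., while the partial derivatives converge in
  -- L².
  have t2 : ∀ i, L2Tendsto (volume.restrict (Ω : Set (Space d)))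
      (fun n x => deriv F (φ n x) * partialDeriv i (φ n) x) (fun x => deriv F (u x) * G i x) :=
    fun i => L2Tendsto.bdd_mul
      (fun n => (hdc.comp (φ n).continuous).aestronglyMeasurable)
      (fun n => Eventually.of_forall fun x => hC _)
      (h.ae_tendsto.mono fun x hx => (hdc.tendsto _).comp hx) (h.tendsto_partial i)
  refine ⟨t1.memLp_lim.toLp _, fun i => (t2 i).memLp_lim.toLp _, ⟨?_, fun i => ?_, ?_⟩,
    t1.memLp_lim.coeFn_toLp, fun i => (t2 i).memLp_lim.coeFn_toLp⟩
  · exact t1.congr (fun n => EventuallyEq.rfl) t1.memLp_lim.coeFn_toLp.symm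
  · refine (t2 i).congr (fun n => Eventually.of_forall fun x => ?_)
      (t2 i).memLp_lim.coeFn_toLp.symm
    exact (partialDeriv_comp hd (φ n) i x).symm
  · filter_upwards [h.ae_tendsto, t1.memLp_lim.coeFn_toLp] with x h1 h2
    rw [h2]
    exact (hF.continuous.tendsto _).comp h1

/-- Each ∂ᵢψ is again a test function, so only the first-order weak derivatives of u are needed. -/
theorem integral_mul_laplacian_test {u : L2 Ω} {G : Fin d → L2 Ω} (h : HasWeakGradient u G)
    (ψ : 𝓓(Ω, ℝ)) : ∫ x in (Ω : Set (Space d)), u x * (Δ (ψ : Space d → ℝ)) x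
      = - ∑ i, ∫ x in (Ω : Set (Space d)), G i x * partialDeriv i ψ x := by
  simp only [laplacian_test, Finset.mul_sum]
  rw [integral_finsetSum _ fun i _ => MemLp.integrable_mul_two (Lp.memLp u)
    (memLp_partialDeriv_test (testPartial i ψ) i), ← Finset.sum_neg_distrib]
  exact Finset.sum_congr rfl fun i _ => h i (testPartial i ψ)

/-- Green's formula against a function of `H¹₀`. -/
theorem HasWeakLaplacian.green {u w v : L2 Ω} {G H : Fin d → L2 Ω} {φ : ℕ → 𝓓(Ω, ℝ)}
    (hw : HasWeakLaplacian u w) (hG : HasWeakGradient u G) (hv : ApproxBy φ v H) :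
    ∫ x in (Ω : Set (Space d)), w x * v x
      = - ∑ i, ∫ x in (Ω : Set (Space d)), G i x * H i x := by
  have h1 := hv.tendsto.integral_mul (Lp.memLp w)
  have h2 := (tendsto_finsetSum Finset.univ
    fun i _ => (hv.tendsto_partial i).integral_mul (Lp.memLp (G i))).neg
  refine tendsto_nhds_unique h1 (h2.congr fun n => ?_)
  rw [← integral_mul_laplacian_test hG, hw]

end Sobolev

/-! ### Smooth truncation of nonpositive functions near their zero set -/

section Truncation

/-- A smooth nonpositive function that vanishes on `[-1, ∞)` and is the identity on `(-∞, -2]`. -/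
noncomputable def smoothTrunc (s : ℝ) : ℝ := s * Real.smoothTransition (-s - 1)

/-- A smooth nondecreasing function that vanishes on `(-∞, -2]` and equals `1` on `[-1, ∞)`. -/
noncomputable def smoothStep (s : ℝ) : ℝ := 1 - Real.smoothTransition (-s - 1)

theorem contDiff_smoothTransition_neg_sub_one :
    ContDiff ℝ ∞ fun s : ℝ => Real.smoothTransition (-s - 1) :=
  (Real.smoothTransition.contDiff (n := ⊤)).comp (contDiff_neg.sub contDiff_const)

theorem contDiff_smoothTrunc : ContDiff ℝ ∞ smoothTrunc :=
  contDiff_id.mul contDiff_smoothTransition_neg_sub_one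

theorem contDiff_smoothStep : ContDiff ℝ ∞ smoothStep :=
  contDiff_const.sub contDiff_smoothTransition_neg_sub_one

theorem smoothTrunc_of_le {s : ℝ} (hs : s ≤ -2) : smoothTrunc s = s := by
  rw [smoothTrunc, Real.smoothTransition.one_of_one_le (by linarith), mul_one]

theorem smoothTrunc_of_ge {s : ℝ} (hs : -1 ≤ s) : smoothTrunc s = 0 := by
  rw [smoothTrunc, Real.smoothTransition.zero_of_nonpos (by linarith), mul_zero]

theorem smoothStep_of_le {s : ℝ} (hs : s ≤ -2) : smoothStep s = 0 := by
  rw [smoothStep, Real.smoothTransition.one_of_one_le (by linarith), sub_self]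

theorem smoothStep_of_ge {s : ℝ} (hs : -1 ≤ s) : smoothStep s = 1 := by
  rw [smoothStep, Real.smoothTransition.zero_of_nonpos (by linarith), sub_zero]

theorem smoothTrunc_nonpos (s : ℝ) : smoothTrunc s ≤ 0 := by
  rcases le_total s 0 with h | h
  · exact mul_nonpos_of_nonpos_of_nonneg h (Real.smoothTransition.nonneg _)
  · rw [smoothTrunc_of_ge (by linarith)]

theorem abs_smoothStep_le (s : ℝ) : |smoothStep s| ≤ 1 := by
  have h1 := Real.smoothTransition.nonneg (-s - 1)
  have h2 := Real.smoothTransition.le_one (-s - 1)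
  rw [smoothStep, abs_le]
  constructor <;> linarith

theorem monotone_smoothStep : Monotone smoothStep := fun s t h =>
  sub_le_sub_left (Real.smoothTransition.monotone (by linarith)) 1

theorem deriv_smoothTrunc_of_lt {s : ℝ} (hs : s < -2) : deriv smoothTrunc s = 1 := by
  have : smoothTrunc =ᶠ[𝓝 s] id := by
    filter_upwards [gt_mem_nhds hs] with t ht using smoothTrunc_of_le ht.le
  rw [this.deriv_eq, deriv_id]

theorem deriv_smoothTrunc_of_gt {s : ℝ} (hs : -1 < s) : deriv smoothTrunc s = 0 := by
  have : smoothTrunc =ᶠ[𝓝 s] fun _ => 0 := by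
    filter_upwards [lt_mem_nhds hs] with t ht using smoothTrunc_of_ge ht.le
  rw [this.deriv_eq, deriv_const]

theorem deriv_smoothStep_of_lt {s : ℝ} (hs : s < -2) : deriv smoothStep s = 0 := by
  have : smoothStep =ᶠ[𝓝 s] fun _ => 0 := by
    filter_upwards [gt_mem_nhds hs] with t ht using smoothStep_of_le ht.le
  rw [this.deriv_eq, deriv_const]

theorem deriv_smoothStep_of_gt {s : ℝ} (hs : -1 < s) : deriv smoothStep s = 0 := by
  have : smoothStep =ᶠ[𝓝 s] fun _ => 1 := by
    filter_upwards [lt_mem_nhds hs] with t ht using smoothStep_of_ge ht.le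
  rw [this.deriv_eq, deriv_const]

theorem exists_abs_le_of_continuous {g : ℝ → ℝ} (hg : Continuous g) {a b A B : ℝ}
    (ha : ∀ s < a, |g s| ≤ A) (hb : ∀ s > b, |g s| ≤ B) : ∃ C, ∀ s, |g s| ≤ C := by
  obtain ⟨D, hD⟩ := (isCompact_Icc (a := a) (b := b)).exists_bound_of_continuousOn hg.continuousOn
  refine ⟨max D (max A B), fun s => ?_⟩
  rcases lt_or_ge s a with h | h
  · exact (ha s h).trans ((le_max_left _ _).trans (le_max_right _ _))
  rcases lt_or_ge b s with h' | h'
  · exact (hb s h').trans ((le_max_right _ _).trans (le_max_right _ _))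
  · exact (hD s ⟨h, h'⟩).trans (le_max_left _ _)

theorem exists_abs_deriv_smoothTrunc_le : ∃ C, ∀ s, |deriv smoothTrunc s| ≤ C :=
  exists_abs_le_of_continuous (contDiff_smoothTrunc.continuous_deriv (by simp))
    (fun s hs => by rw [deriv_smoothTrunc_of_lt hs]) (fun s hs => by rw [deriv_smoothTrunc_of_gt hs])

theorem exists_abs_deriv_smoothStep_le : ∃ C, ∀ s, |deriv smoothStep s| ≤ C :=
  exists_abs_le_of_continuous (contDiff_smoothStep.continuous_deriv (by simp))
    (fun s hs => by rw [deriv_smoothStep_of_lt hs]) (fun s hs => by rw [deriv_smoothStep_of_gt hs])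

theorem tendsto_natCast_add_one_mul_atBot {s : ℝ} (hs : s < 0) :
    Tendsto (fun k : ℕ => ((k : ℝ) + 1) * s) atTop atBot :=
  (tendsto_atTop_add_const_right _ 1 tendsto_natCast_atTop_atTop).atTop_mul_const_of_neg hs

variable {d : ℕ} {Ω : Opens (Space d)}

/-- A nonpositive function of `H¹₀` is a limit in `H¹` of functions of `H¹₀` that vanish where the
given function is close to `0` and that are limits of nonpositive test functions; its gradient
vanishes a.e. on its zero set. -/
theorem ApproxBy.exists_truncation {φ : ℕ → 𝓓(Ω, ℝ)} {u : L2 Ω} {G : Fin d → L2 Ω}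
    (h : ApproxBy φ u G) (hu : ∀ᵐ x ∂(volume.restrict (Ω : Set (Space d))), u x ≤ 0) :
    (∀ i, ∀ᵐ x ∂(volume.restrict (Ω : Set (Space d))), u x = 0 → G i x = 0) ∧
    ∃ (ψ : ℕ → ℕ → 𝓓(Ω, ℝ)) (v : ℕ → L2 Ω) (H : ℕ → Fin d → L2 Ω),
      (∀ k, ApproxBy (ψ k) (v k) (H k)) ∧ (∀ k n x, ψ k n x ≤ 0) ∧
      (∀ k, ∃ ε : ℝ, 0 < ε ∧
        ∀ᵐ x ∂(volume.restrict (Ω : Set (Space d))), -ε < u x → v k x = 0) ∧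
      L2Tendsto (volume.restrict (Ω : Set (Space d))) (fun k => v k) u ∧
      ∀ i, L2Tendsto (volume.restrict (Ω : Set (Space d))) (fun k => H k i) (G i) := by
  obtain ⟨C, hC⟩ := exists_abs_deriv_smoothTrunc_le
  have hpos : ∀ k : ℕ, (0 : ℝ) < (k : ℝ) + 1 := fun k => by positivity
  -- The rescaled truncation vanishes for s ≥ -1/(k+1) and is the identity for s ≤ -2/(k+1). Scaling
  -- inside and out leaves the bound on its derivative independent of k.
  set F : ℕ → ℝ → ℝ := fun k s => ((k : ℝ) + 1)⁻¹ * smoothTrunc (((k : ℝ) + 1) * s) with hFdef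
  have hF : ∀ k, ContDiff ℝ ∞ (F k) := fun k =>
    contDiff_const.mul (contDiff_smoothTrunc.comp (contDiff_const.mul contDiff_id))
  have hF0 : ∀ k, F k 0 = 0 := fun k => by simp [hFdef, smoothTrunc]
  have hF' : ∀ k s, deriv (F k) s = deriv smoothTrunc (((k : ℝ) + 1) * s) := by
    intro k s
    have h1 : HasDerivAt (fun s : ℝ => ((k : ℝ) + 1) * s) ((k : ℝ) + 1) s := by
      simpa using (hasDerivAt_id s).const_mul ((k : ℝ) + 1)
    have h2 := ((contDiff_smoothTrunc.differentiable (by simp)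
      (((k : ℝ) + 1) * s)).hasDerivAt.comp s h1).const_mul ((k : ℝ) + 1)⁻¹
    have h3 : HasDerivAt (F k) _ s := h2
    rw [h3.deriv]
    field_simp [(hpos k).ne']
  have hFC : ∀ k s, |deriv (F k) s| ≤ C := fun k s => by rw [hF']; exact hC _
  have hFmul : ∀ k s, F k s = Real.smoothTransition (-(((k : ℝ) + 1) * s) - 1) * s := by
    intro k s
    simp only [hFdef, smoothTrunc]
    field_simp [(hpos k).ne']
  choose v H hvH hv hH using fun k => h.comp (hF k) (hF0 k) (hFC k)
  have tv : L2Tendsto (volume.restrict (Ω : Set (Space d))) (fun k => v k) u := by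
    have t := L2Tendsto.bdd_mul_const (μ := volume.restrict (Ω : Set (Space d)))
      (b := fun (k : ℕ) x => Real.smoothTransition (-(((k : ℝ) + 1) * u x) - 1))
      -- At u = 0 the cutoff is constantly `Real.smoothTransition (-1)`; the value is immaterial
      -- because it multiplies u = 0.
      (b₀ := fun x => if u x < 0 then 1 else Real.smoothTransition (-1)) (g := u) (C := 1)
      (fun k => (Real.smoothTransition.continuous.comp (by fun_prop :
        Continuous fun s : ℝ => -(((k : ℝ) + 1) * s) - 1)).comp_aestronglyMeasurable (Lp.memLp u).1)
      (fun k => Eventually.of_forall fun x => by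
        rw [abs_of_nonneg (Real.smoothTransition.nonneg _)]
        exact Real.smoothTransition.le_one _) ?_ (Lp.memLp u)
    · refine t.congr (fun k => ?_) ?_
      · filter_upwards [hv k] with x hx
        rw [hx, hFmul]
      · filter_upwards [hu] with x hx
        split_ifs with h0
        · rw [one_mul]
        · rw [le_antisymm hx (not_lt.1 h0), mul_zero]
    · filter_upwards [hu] with x hx
      split_ifs with h0
      · refine tendsto_const_nhds.congr' ?_
        filter_upwards [(tendsto_natCast_add_one_mul_atBot h0).eventually_le_atBot (-2)] with k hk
        rw [Real.smoothTransition.one_of_one_le (by linarith)]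
      · rw [le_antisymm hx (not_lt.1 h0)]
        simp
  have tH : ∀ i, L2Tendsto (volume.restrict (Ω : Set (Space d))) (fun k => H k i)
      (fun x => (if u x < 0 then 1 else 0) * G i x) := by
    intro i
    have t := L2Tendsto.bdd_mul_const (μ := volume.restrict (Ω : Set (Space d)))
      (b := fun (k : ℕ) x => deriv (F k) (u x))
      (b₀ := fun x => if u x < 0 then 1 else 0) (g := G i) (C := C)
      (fun k => ((hF k).continuous_deriv (by simp)).comp_aestronglyMeasurable (Lp.memLp u).1)
      (fun k => Eventually.of_forall fun x => hFC k _) ?_ (Lp.memLp (G i))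
    · exact t.congr (fun k => (hH k i).symm) EventuallyEq.rfl
    · filter_upwards [hu] with x hx
      split_ifs with h0
      · refine tendsto_const_nhds.congr' ?_
        filter_upwards [(tendsto_natCast_add_one_mul_atBot h0).eventually_lt_atBot (-2)] with k hk
        rw [hF', deriv_smoothTrunc_of_lt hk]
      · rw [le_antisymm hx (not_lt.1 h0)]
        simp only [hF', mul_zero]
        rw [deriv_smoothTrunc_of_gt (by norm_num)]
        exact tendsto_const_nhds
  -- The truncations converge to u and their gradients to 1_{u<0} G, so the latter is also a weak
  -- gradient of u. Uniqueness forces it to equal G, which gives both the vanishing of G on {u = 0}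
  -- and the H¹ convergence.
  have hGae : ∀ i, (fun x => (if u x < 0 then 1 else 0) * G i x)
      =ᵐ[volume.restrict (Ω : Set (Space d))] G i := by
    intro i
    have m := (tH i).memLp_lim
    have t' := (tH i).congr (fun k => EventuallyEq.rfl) m.coeFn_toLp.symm
    have hw : HasWeakPartial i u (m.toLp _) :=
      hasWeakPartial_of_tendsto tv t' fun k ψ => (hvH k).hasWeakGradient i ψ
    have e := hw.ae_unique (h.hasWeakGradient i)
    have := m.coeFn_toLp
    rw [e] at this
    exact this.symm
  refine ⟨fun i => ?_, fun k n => testComp (F k) (hF k) (hF0 k) (φ n), v, H, hvH, ?_, ?_, tv,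
    fun i => (tH i).congr (fun k => EventuallyEq.rfl) (hGae i)⟩
  · filter_upwards [hGae i] with x hx h0
    rw [← hx]
    simp [h0]
  · intro k n x
    exact mul_nonpos_of_nonneg_of_nonpos (inv_nonneg.2 (hpos k).le) (smoothTrunc_nonpos _)
  · intro k
    refine ⟨((k : ℝ) + 1)⁻¹, inv_pos.2 (hpos k), ?_⟩
    filter_upwards [hv k] with x hx hlt
    rw [hx]
    simp only [hFdef]
    rw [smoothTrunc_of_ge, mul_zero]
    have := mul_lt_mul_of_pos_left hlt (hpos k)
    rw [mul_neg, mul_inv_cancel₀ (hpos k).ne'] at this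
    exact this.le

end Truncation

/-! ### Sign of the Laplacian on the contact set -/

section Contact

variable {d : ℕ} {Ω : Opens (Space d)}

/-- Multiplication of a smooth bounded function of `u ∈ H¹₀` by a test function. -/
theorem ApproxBy.comp_mul {φ : ℕ → 𝓓(Ω, ℝ)} {u : L2 Ω} {G : Fin d → L2 Ω} (h : ApproxBy φ u G)
    {F : ℝ → ℝ} (hF : ContDiff ℝ ∞ F) {B C : ℝ} (hB : ∀ s, |F s| ≤ B) (hC : ∀ s, |deriv F s| ≤ C)
    (ψ : 𝓓(Ω, ℝ)) :
    ∃ (v : L2 Ω) (H : Fin d → L2 Ω), ApproxBy (fun n => testCompMul F hF (φ n) ψ) v H ∧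
      v =ᵐ[volume.restrict (Ω : Set (Space d))] (fun x => F (u x) * ψ x) ∧
      ∀ i, H i =ᵐ[volume.restrict (Ω : Set (Space d))] fun x =>
        deriv F (u x) * ψ x * G i x + F (u x) * partialDeriv i ψ x := by
  have hdc : Continuous (deriv F) := hF.continuous_deriv (by simp)
  obtain ⟨M, hM⟩ := ψ.continuous.bounded_above_of_compact_support ψ.hasCompactSupport
  have tF : ∀ {g : Space d → ℝ}, MemLp g 2 (volume.restrict (Ω : Set (Space d))) →
      L2Tendsto (volume.restrict (Ω : Set (Space d))) (fun n x => F (φ n x) * g x)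
        (fun x => F (u x) * g x) := fun hg =>
    L2Tendsto.bdd_mul_const (fun n => (hF.continuous.comp (φ n).continuous).aestronglyMeasurable)
      (fun n => Eventually.of_forall fun x => hB _)
      (h.ae_tendsto.mono fun x hx => (hF.continuous.tendsto _).comp hx) hg
  have t1 := tF (memLp_test ψ)
  have t2 : ∀ i, L2Tendsto (volume.restrict (Ω : Set (Space d)))
      (fun n x => deriv F (φ n x) * ψ x * partialDeriv i (φ n) x + F (φ n x) * partialDeriv i ψ x)
      (fun x => deriv F (u x) * ψ x * G i x + F (u x) * partialDeriv i ψ x) := by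
    intro i
    refine L2Tendsto.add (L2Tendsto.bdd_mul (C := C * M)
      (b := fun n x => deriv F (φ n x) * ψ x) (b₀ := fun x => deriv F (u x) * ψ x)
      (fun n => ((hdc.comp (φ n).continuous).mul ψ.continuous).aestronglyMeasurable)
      (fun n => Eventually.of_forall fun x => ?_)
      (h.ae_tendsto.mono fun x hx => ((hdc.tendsto _).comp hx).mul_const _) (h.tendsto_partial i))
      (tF (memLp_partialDeriv_test ψ i))
    rw [abs_mul]
    exact mul_le_mul (hC _) (hM x) (abs_nonneg _) ((abs_nonneg _).trans (hC 0))
  refine ⟨t1.memLp_lim.toLp _, fun i => (t2 i).memLp_lim.toLp _, ⟨?_, fun i => ?_, ?_⟩,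
    t1.memLp_lim.coeFn_toLp, fun i => (t2 i).memLp_lim.coeFn_toLp⟩
  · exact t1.congr (fun n => EventuallyEq.rfl) t1.memLp_lim.coeFn_toLp.symm
  · refine (t2 i).congr (fun n => Eventually.of_forall fun x => ?_)
      (t2 i).memLp_lim.coeFn_toLp.symm
    exact (partialDeriv_testCompMul hF (φ n) ψ i x).symm
  · filter_upwards [h.ae_tendsto, t1.memLp_lim.coeFn_toLp] with x h1 h2
    rw [h2]
    exact ((hF.continuous.tendsto _).comp h1).mul_const _

/-- The Laplacian of a nonpositive function of `H¹₀` is nonpositive on the zero set of the function: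
integrals against nonnegative test functions. -/
theorem HasWeakLaplacian.integral_contact_test_nonpos {u w : L2 Ω} {G : Fin d → L2 Ω}
    {φ : ℕ → 𝓓(Ω, ℝ)} (hw : HasWeakLaplacian u w) (h : ApproxBy φ u G)
    (hu : ∀ᵐ x ∂(volume.restrict (Ω : Set (Space d))), u x ≤ 0) (ψ : 𝓓(Ω, ℝ))
    (hψ : ∀ x, 0 ≤ ψ x) :
    ∫ x in (Ω : Set (Space d)), w x * ((if u x < 0 then 0 else 1) * ψ x) ≤ 0 := by
  obtain ⟨C, hC⟩ := exists_abs_deriv_smoothStep_le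
  have hpos : ∀ k : ℕ, (0 : ℝ) < (k : ℝ) + 1 := fun k => by positivity
  -- On (-∞, 0] these nondecreasing functions converge pointwise to the indicator of {0}.
  set F : ℕ → ℝ → ℝ := fun k s => smoothStep (((k : ℝ) + 1) * s) with hFdef
  have hF : ∀ k, ContDiff ℝ ∞ (F k) := fun k =>
    contDiff_smoothStep.comp (contDiff_const.mul contDiff_id)
  have hF' : ∀ k s, deriv (F k) s = ((k : ℝ) + 1) * deriv smoothStep (((k : ℝ) + 1) * s) := by
    intro k s
    have h1 : HasDerivAt (fun s : ℝ => ((k : ℝ) + 1) * s) ((k : ℝ) + 1) s := by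
      simpa using (hasDerivAt_id s).const_mul ((k : ℝ) + 1)
    have h2 := (contDiff_smoothStep.differentiable (by simp)
      (((k : ℝ) + 1) * s)).hasDerivAt.comp s h1
    have h3 : HasDerivAt (F k) _ s := h2
    rw [h3.deriv, mul_comm]
  have hFB : ∀ k s, |F k s| ≤ 1 := fun k s => abs_smoothStep_le _
  -- This bound grows with k, but it only serves to form the test function F k(u) ψ for fixed k; the
  -- limit in k uses the uniform bound `hFB`.
  have hFC : ∀ k s, |deriv (F k) s| ≤ ((k : ℝ) + 1) * C := fun k s => by
    rw [hF', abs_mul, abs_of_pos (hpos k)]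
    exact mul_le_mul_of_nonneg_left (hC _) (hpos k).le
  have hFnn : ∀ k s, 0 ≤ deriv (F k) s := fun k s => by
    rw [hF']
    exact mul_nonneg (hpos k).le monotone_smoothStep.deriv_nonneg
  choose v H hvH hv hH using fun k => h.comp_mul (hF k) (hFB k) (hFC k) ψ
  have tF : ∀ {g : Space d → ℝ}, MemLp g 2 (volume.restrict (Ω : Set (Space d))) →
      L2Tendsto (volume.restrict (Ω : Set (Space d))) (fun k x => F k (u x) * g x)
        (fun x => (if u x < 0 then 0 else 1) * g x) := by
    intro g hg
    refine L2Tendsto.bdd_mul_const (C := 1)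
      (fun k => (hF k).continuous.comp_aestronglyMeasurable (Lp.memLp u).1)
      (fun k => Eventually.of_forall fun x => hFB k _) ?_ hg
    filter_upwards [hu] with x hx
    split_ifs with h0
    · refine tendsto_const_nhds.congr' ?_
      filter_upwards [(tendsto_natCast_add_one_mul_atBot h0).eventually_le_atBot (-2)] with k hk
      exact (smoothStep_of_le hk).symm
    · rw [le_antisymm hx (not_lt.1 h0)]
      simp only [hFdef, mul_zero]
      rw [smoothStep_of_ge (by norm_num)]
      exact tendsto_const_nhds
  have lim1 := (tF (memLp_test ψ)).integral_mul (Lp.memLp w)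
  have lim2 := (tendsto_finsetSum Finset.univ fun i _ =>
    (tF (memLp_partialDeriv_test ψ i)).integral_mul (Lp.memLp (G i))).neg
  have hzero : ∀ i, ∫ x in (Ω : Set (Space d)),
      G i x * ((if u x < 0 then 0 else 1) * partialDeriv i ψ x) = 0 := by
    intro i
    refine integral_eq_zero_of_ae ?_
    filter_upwards [hu, (h.exists_truncation hu).1 i] with x hx h0
    split_ifs with hlt
    · simp
    · rw [h0 (le_antisymm hx (not_lt.1 hlt))]
      simp
  simp only [hzero, Finset.sum_const_zero, neg_zero] at lim2
  -- By Green, ∫ w F k(u) ψ = -∫ F k'(u) ψ |∇u|² - ∫ F k(u) ∇u·∇ψ. The first term is nonpositive and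
  -- is dropped; the second tends to 0 because ∇u = 0 a.e. on {u = 0}.
  refine le_of_tendsto_of_tendsto' lim1 lim2 fun k => ?_
  have green := hw.green h.hasWeakGradient (hvH k)
  have e1 : ∫ x in (Ω : Set (Space d)), w x * v k x
      = ∫ x in (Ω : Set (Space d)), w x * (F k (u x) * ψ x) :=
    integral_congr_ae ((hv k).mono fun x hx => by simp only [hx])
  rw [← e1, green, neg_le_neg_iff]
  refine Finset.sum_le_sum fun i _ => integral_mono_ae
    (MemLp.integrable_mul_two (Lp.memLp (G i)) ((tF (memLp_partialDeriv_test ψ i)).memLp k))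
    (MemLp.integrable_mul_two (Lp.memLp (G i)) (Lp.memLp (H k i))) ?_
  filter_upwards [hH k i] with x hx
  rw [hx]
  have := mul_nonneg (mul_nonneg (hFnn k (u x)) (hψ x)) (mul_self_nonneg (G i x))
  nlinarith

theorem aestronglyMeasurable_ite_neg {u : L2 Ω} : AEStronglyMeasurable
    (fun x => if u x < 0 then (0 : ℝ) else 1) (volume.restrict (Ω : Set (Space d))) :=
  ((Measurable.ite measurableSet_Iio measurable_const measurable_const :
    Measurable fun s : ℝ => if s < 0 then (0 : ℝ) else 1).comp_aemeasurable
      (Lp.memLp u).1.aemeasurable).aestronglyMeasurable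

theorem memLp_ite_neg_mul (u : L2 Ω) {g : Space d → ℝ}
    (hg : MemLp g 2 (volume.restrict (Ω : Set (Space d)))) :
    MemLp (fun x => (if u x < 0 then (0 : ℝ) else 1) * g x) 2
      (volume.restrict (Ω : Set (Space d))) :=
  memLp_bdd_mul (C := 1) aestronglyMeasurable_ite_neg (Eventually.of_forall fun x => by
    split_ifs <;> simp) hg

/-- The Laplacian of a nonpositive function of `H¹₀` is nonpositive on the zero set of the function:
integrals against nonnegative functions of `H¹₀`. -/
theorem HasWeakLaplacian.integral_contact_nonpos {u w m : L2 Ω} {G Gm : Fin d → L2 Ω}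
    {φ φm : ℕ → 𝓓(Ω, ℝ)} (hw : HasWeakLaplacian u w) (h : ApproxBy φ u G)
    (hu : ∀ᵐ x ∂(volume.restrict (Ω : Set (Space d))), u x ≤ 0) (hm : ApproxBy φm m Gm)
    (hm0 : ∀ᵐ x ∂(volume.restrict (Ω : Set (Space d))), 0 ≤ m x) :
    ∫ x in (Ω : Set (Space d)), (if u x < 0 then 0 else 1) * w x * m x ≤ 0 := by
  have hneg : ∀ᵐ x ∂(volume.restrict (Ω : Set (Space d))), (-m : L2 Ω) x ≤ 0 := by
    filter_upwards [hm0, Lp.coeFn_neg m] with x h1 h2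
    rw [h2]
    simpa using h1
  -- Truncating -m ≤ 0 provides nonpositive test functions ψ k n; their negatives are nonnegative
  -- and approximate m.
  obtain ⟨-, ψ, v, H, hψ, hψ0, -, hv, -⟩ := hm.neg.exists_truncation hneg
  have hcw := memLp_ite_neg_mul u (Lp.memLp w)
  have key : ∀ k n, 0 ≤ ∫ x in (Ω : Set (Space d)),
      (if u x < 0 then 0 else 1) * w x * ψ k n x := by
    intro k n
    have := hw.integral_contact_test_nonpos h hu (-ψ k n) (fun x => by
      simpa using hψ0 k n x)
    have e : ∀ x, w x * ((if u x < 0 then 0 else 1) * (-ψ k n : 𝓓(Ω, ℝ)) x)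
        = -((if u x < 0 then 0 else 1) * w x * ψ k n x) := by
      intro x
      have : (-ψ k n : 𝓓(Ω, ℝ)) x = -ψ k n x := rfl
      rw [this]
      ring
    simp only [e, integral_neg] at this
    linarith
  have key2 : ∀ k, 0 ≤ ∫ x in (Ω : Set (Space d)), (if u x < 0 then 0 else 1) * w x * v k x :=
    fun k => ge_of_tendsto' ((hψ k).tendsto.integral_mul hcw) (key k)
  have key3 := ge_of_tendsto' (hv.integral_mul hcw) key2
  have e : ∫ x in (Ω : Set (Space d)), (if u x < 0 then 0 else 1) * w x * (-m : L2 Ω) x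
      = -∫ x in (Ω : Set (Space d)), (if u x < 0 then 0 else 1) * w x * m x := by
    rw [← integral_neg]
    refine integral_congr_ae ?_
    filter_upwards [Lp.coeFn_neg m] with x hx
    rw [hx]
    simp
  rw [e] at key3
  linarith

end Contact

/-! ### Energy identities, the two cost inequalities and the obstacle problem -/

section Uniqueness

variable {d : ℕ} {Ω : Opens (Space d)}

theorem integrable_mul_L2 (u v : L2 Ω) :
    Integrable (fun x => u x * v x) (volume.restrict (Ω : Set (Space d))) :=
  MemLp.integrable_mul_two (Lp.memLp u) (Lp.memLp v)

theorem integral_sub_add_add {α : Type*} [MeasurableSpace α] {μ : Measure α} {a b c e : α → ℝ}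
    (ha : Integrable a μ) (hb : Integrable b μ) (hc : Integrable c μ) (he : Integrable e μ) :
    ∫ x, (a x - b x + c x + e x) ∂μ
      = (∫ x, a x ∂μ) - (∫ x, b x ∂μ) + (∫ x, c x ∂μ) + ∫ x, e x ∂μ := by
  have h1 := integral_add ((ha.sub hb).add hc) he
  have h2 := integral_add (ha.sub hb) hc
  simp only [Pi.add_apply, Pi.sub_apply] at h1 h2
  rw [h1, h2, integral_sub ha hb]

theorem integral_sub_sub_add {α : Type*} [MeasurableSpace α] {μ : Measure α} {a b c e : α → ℝ}
    (ha : Integrable a μ) (hb : Integrable b μ) (hc : Integrable c μ) (he : Integrable e μ) :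
    ∫ x, (a x - b x - c x + e x) ∂μ
      = (∫ x, a x ∂μ) - (∫ x, b x ∂μ) - (∫ x, c x ∂μ) + ∫ x, e x ∂μ := by
  simpa [sub_eq_add_neg, integral_neg] using integral_sub_add_add ha hb hc.neg he

/-- The equation on `{u < 0}` may be tested with `u` itself. -/
theorem SolvesOnNegativeSet.energy_eq {ρ : 𝓓(Ω, ℝ)} {u m : L2 Ω} {G Gm : Fin d → L2 Ω}
    {φ : ℕ → 𝓓(Ω, ℝ)} (h : SolvesOnNegativeSet ρ u m) (hu : ApproxBy φ u G)
    (hu0 : ∀ᵐ x ∂(volume.restrict (Ω : Set (Space d))), u x ≤ 0) (hm : HasWeakGradient m Gm) :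
    (∑ i, ∫ x in (Ω : Set (Space d)), Gm i x * G i x) + ∫ x in (Ω : Set (Space d)), m x * u x
      = ∫ x in (Ω : Set (Space d)), ρ x * u x := by
  -- Each truncation of u vanishes on some {u > -ε}, hence is an admissible test function; u is
  -- recovered as an H¹ limit.
  obtain ⟨-, ψ, v, H, hψ, -, hsupp, hv, hH⟩ := hu.exists_truncation hu0
  have lim1 := (tendsto_finsetSum Finset.univ
    fun i _ => (hH i).integral_mul (Lp.memLp (Gm i))).add (hv.integral_mul (Lp.memLp m))
  have lim2 := hv.integral_mul (memLp_test ρ)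
  refine tendsto_nhds_unique lim1 (lim2.congr fun k => ?_)
  rw [← h (v k) (H k) Gm (hψ k).memH10 (hψ k).hasWeakGradient hm (hsupp k),
    integral_add (integrable_finsetSum _ fun i _ => integrable_mul_L2 _ _) (integrable_mul_L2 _ _),
    integral_finsetSum _ fun i _ => integrable_mul_L2 _ _]

/-- One integration by parts puts the distributional inequality in a form that is stable under H¹
limits of the test function. -/
theorem IsSubsolution.energy_test {ρ : 𝓓(Ω, ℝ)} {m : L2 Ω} {Gm : Fin d → L2 Ω}
    (h : IsSubsolution ρ m) (hm : HasWeakGradient m Gm) (ψ : 𝓓(Ω, ℝ)) (hψ : ∀ x, 0 ≤ ψ x) :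
    (∑ i, ∫ x in (Ω : Set (Space d)), Gm i x * partialDeriv i ψ x)
      + ∫ x in (Ω : Set (Space d)), m x * ψ x ≤ ∫ x in (Ω : Set (Space d)), ρ x * ψ x := by
  have hΔ : MemLp (Δ (ψ : Space d → ℝ)) 2 (volume.restrict (Ω : Set (Space d))) := by
    have : (Δ (ψ : Space d → ℝ)) = fun x => ∑ i, partialDeriv i (testPartial i ψ) x :=
      funext (laplacian_test ψ)
    rw [this]
    exact memLp_finsetSum _ fun i _ => memLp_partialDeriv_test (testPartial i ψ) i
  refine le_trans (le_of_eq ?_) (h ψ hψ)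
  have e := integral_mul_laplacian_test hm ψ
  have : ∀ x, m x * (-(Δ (ψ : Space d → ℝ)) x + ψ x)
      = m x * ψ x - m x * (Δ (ψ : Space d → ℝ)) x := fun x => by ring
  simp only [this]
  rw [integral_sub (MemLp.integrable_mul_two (Lp.memLp m) (memLp_test ψ))
    (MemLp.integrable_mul_two (Lp.memLp m) hΔ), e]
  ring

/-- The subsolution inequality may be tested with nonpositive functions of `H¹₀`. -/
theorem IsSubsolution.energy_ge {ρ : 𝓓(Ω, ℝ)} {u m : L2 Ω} {G Gm : Fin d → L2 Ω}
    {φ : ℕ → 𝓓(Ω, ℝ)} (h : IsSubsolution ρ m) (hu : ApproxBy φ u G)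
    (hu0 : ∀ᵐ x ∂(volume.restrict (Ω : Set (Space d))), u x ≤ 0) (hm : HasWeakGradient m Gm) :
    ∫ x in (Ω : Set (Space d)), ρ x * u x ≤
    (∑ i, ∫ x in (Ω : Set (Space d)), Gm i x * G i x) + ∫ x in (Ω : Set (Space d)), m x * u x := by
  obtain ⟨-, ψ, v, H, hψ, hψ0, -, hv, hH⟩ := hu.exists_truncation hu0
  -- The negative of ψ k n is a nonnegative test function, so the inequality reverses.
  have key : ∀ k n, ∫ x in (Ω : Set (Space d)), ρ x * ψ k n x ≤
      (∑ i, ∫ x in (Ω : Set (Space d)), Gm i x * partialDeriv i (ψ k n) x)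
        + ∫ x in (Ω : Set (Space d)), m x * ψ k n x := by
    intro k n
    have e := h.energy_test hm (-ψ k n) fun x => by simpa using hψ0 k n x
    have e' : ((-ψ k n : 𝓓(Ω, ℝ)) : Space d → ℝ) = fun x => -ψ k n x := rfl
    simp only [partialDeriv_neg_test, Pi.neg_apply, mul_neg, integral_neg, Finset.sum_neg_distrib]
      at e
    simp only [e', mul_neg, integral_neg] at e
    linarith
  have key2 : ∀ k, ∫ x in (Ω : Set (Space d)), ρ x * v k x ≤
      (∑ i, ∫ x in (Ω : Set (Space d)), Gm i x * H k i x)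
        + ∫ x in (Ω : Set (Space d)), m x * v k x := fun k =>
    le_of_tendsto_of_tendsto' ((hψ k).tendsto.integral_mul (memLp_test ρ))
      ((tendsto_finsetSum Finset.univ fun i _ => ((hψ k).tendsto_partial i).integral_mul
        (Lp.memLp (Gm i))).add ((hψ k).tendsto.integral_mul (Lp.memLp m))) (key k)
  exact le_of_tendsto_of_tendsto' (hv.integral_mul (memLp_test ρ))
    ((tendsto_finsetSum Finset.univ fun i _ => (hH i).integral_mul
      (Lp.memLp (Gm i))).add (hv.integral_mul (Lp.memLp m))) key2

/-- The number `a` plays the role of -Δu. Where u < 0 the maximum 0 must be attained by the other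
entry. -/
theorem obstacle_cases {a u h : ℝ} (hmax : max (a + u - h) u = 0) :
    u ≤ 0 ∧ a + u ≤ h ∧ (u < 0 → a + u = h) := by
  have h1 := le_max_left (a + u - h) u
  have h2 := le_max_right (a + u - h) u
  refine ⟨by linarith, by linarith, fun hu => ?_⟩
  rcases max_choice (a + u - h) u with e | e <;> linarith

theorem SolvesObstacle.nonpos {u h : L2 Ω} (hu : SolvesObstacle u h) :
    ∀ᵐ x ∂(volume.restrict (Ω : Set (Space d))), u x ≤ 0 := by
  obtain ⟨w, -, hw⟩ := hu
  exact hw.mono fun x hx => (obstacle_cases hx).1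

/-- The cost of a mixed solution is bounded by the value of the sources. -/
theorem IsMixedSolution.integral_cost_le {f : L2 Ω → L2 Ω} {ρ : 𝓓(Ω, ℝ)} {u m : L2 Ω}
    (h : IsMixedSolution f ρ u m) :
    ∫ x in (Ω : Set (Space d)), f m x * m x ≤ ∫ x in (Ω : Set (Space d)), ρ x * u x := by
  obtain ⟨G, φ, -, hu⟩ := h.u_memH10.exists_approxBy
  obtain ⟨Gm, φm, hGm, hm⟩ := h.m_memH10.exists_approxBy
  have hu0 := h.obstacle.nonpos
  obtain ⟨w, hw, hob⟩ := h.obstacle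
  -- As u ≤ 0 a.e., the weight is the indicator of {u = 0}.
  have hcontact : ∫ x in (Ω : Set (Space d)), (if u x < 0 then 0 else 1) * f m x * m x = 0 := by
    have hs : MeasurableSet {x : Space d | u x = 0} :=
      (Lp.stronglyMeasurable u).measurable (measurableSet_singleton 0)
    have e := setIntegral_indicator (μ := volume) (s := (Ω : Set (Space d)))
      (f := fun x => f m x * m x) hs
    refine Eq.trans (integral_congr_ae ?_) (e.trans h.contact)
    filter_upwards [hu0] with x hx
    rcases hx.lt_or_eq with hlt | heq
    · simp [hlt, hlt.ne]
    · simp [heq]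
  have hneg := hw.integral_contact_nonpos hu hu0 hm h.m_nonneg
  have green := hw.green hu.hasWeakGradient hm
  have energy := h.eq_on_neg.energy_eq hu hu0 hGm
  -- On {u < 0} this is f(m) = -w + u times m; on {u = 0} the two terms in w cancel.
  have hpt : ∀ᵐ x ∂(volume.restrict (Ω : Set (Space d))), f m x * m x
      = m x * u x - w x * m x + (if u x < 0 then 0 else 1) * w x * m x
        + (if u x < 0 then 0 else 1) * f m x * m x := by
    filter_upwards [hob] with x hx
    obtain ⟨h1, h2, h3⟩ := obstacle_cases hx
    rcases h1.lt_or_eq with hlt | heq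
    · rw [if_pos hlt, ← h3 hlt]
      ring
    · simp [heq]
  have i1 := integrable_mul_L2 m u
  have i2 := integrable_mul_L2 w m
  have i3 := MemLp.integrable_mul_two (memLp_ite_neg_mul u (Lp.memLp w)) (Lp.memLp m)
  have i4 := MemLp.integrable_mul_two (memLp_ite_neg_mul u (Lp.memLp (f m))) (Lp.memLp m)
  rw [integral_congr_ae hpt, integral_sub_add_add i1 i2 i3 i4, hcontact, green, ← energy]
  simp only [mul_comm (Gm _ _)]
  linarith

/-- The cost of a mixed solution, tested with a competitor, is at least the value of the sources. -/
theorem IsMixedSolution.le_integral_cost {f : L2 Ω → L2 Ω} {ρ : 𝓓(Ω, ℝ)} {u m u' m' : L2 Ω}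
    (h : IsMixedSolution f ρ u m) (h' : IsMixedSolution f ρ u' m') :
    ∫ x in (Ω : Set (Space d)), ρ x * u x ≤ ∫ x in (Ω : Set (Space d)), f m x * m' x := by
  obtain ⟨G, φ, -, hu⟩ := h.u_memH10.exists_approxBy
  obtain ⟨Gm, φm, hGm, hm⟩ := h'.m_memH10.exists_approxBy
  have hu0 := h.obstacle.nonpos
  obtain ⟨w, hw, hob⟩ := h.obstacle
  have green := hw.green hu.hasWeakGradient hm
  have energy := h'.subsolution.energy_ge hu hu0 hGm
  have i1 := integrable_mul_L2 m' u
  have i2 := integrable_mul_L2 w m'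
  have hle : ∫ x in (Ω : Set (Space d)), (m' x * u x - w x * m' x)
      ≤ ∫ x in (Ω : Set (Space d)), f m x * m' x := by
    refine integral_mono_ae (i1.sub i2) (integrable_mul_L2 _ _) ?_
    filter_upwards [hob, h'.m_nonneg] with x hx hx'
    have := mul_le_mul_of_nonneg_right (obstacle_cases hx).2.1 hx'
    linarith
  rw [integral_sub i1 i2, green] at hle
  simp only [mul_comm (Gm _ _)] at energy
  linarith

/-- The solution of the obstacle problem in `H¹₀` is unique. -/
theorem SolvesObstacle.unique {u u' h : L2 Ω} (hu : SolvesObstacle u h) (hu' : SolvesObstacle u' h)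
    (hH : MemH10 u) (hH' : MemH10 u') : u = u' := by
  obtain ⟨w, hw, hob⟩ := hu
  obtain ⟨w', hw', hob'⟩ := hu'
  obtain ⟨G, φ, hG, ha⟩ := hH.exists_approxBy
  obtain ⟨G', φ', hG', ha'⟩ := hH'.exists_approxBy
  have g1 := hw.green hG ha
  have g2 := hw.green hG ha'
  have g3 := hw'.green hG' ha
  have g4 := hw'.green hG' ha'
  have energy : 0 ≤ ∑ i, ∫ x in (Ω : Set (Space d)), (G i x - G' i x) ^ 2 :=
    Finset.sum_nonneg fun i _ => integral_nonneg fun x => sq_nonneg _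
  have expand : ∀ i, ∫ x in (Ω : Set (Space d)), (G i x - G' i x) ^ 2
      = (∫ x in (Ω : Set (Space d)), G i x * G i x) - (∫ x in (Ω : Set (Space d)), G i x * G' i x)
        - (∫ x in (Ω : Set (Space d)), G' i x * G i x)
        + ∫ x in (Ω : Set (Space d)), G' i x * G' i x := by
    intro i
    rw [← integral_sub_sub_add (integrable_mul_L2 _ _) (integrable_mul_L2 _ _)
      (integrable_mul_L2 _ _) (integrable_mul_L2 _ _)]
    congr 1
    ext x
    ring
  simp only [expand, Finset.sum_add_distrib, Finset.sum_sub_distrib] at energy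
  have i1 := integrable_mul_L2 w u
  have i2 := integrable_mul_L2 w u'
  have i3 := integrable_mul_L2 w' u
  have i4 := integrable_mul_L2 w' u'
  have hsq : Integrable (fun x => (u x - u' x) ^ 2) (volume.restrict (Ω : Set (Space d))) :=
    ((Lp.memLp u).sub (Lp.memLp u')).integrable_sq
  -- Pointwise, (u - u')² ≤ (w - w')(u - u'): equality if both are negative or both vanish, and
  -- otherwise the equation on one side meets the inequality on the other. By Green the right side
  -- integrates to -∫ |G - G'|² ≤ 0.
  have hle : ∫ x in (Ω : Set (Space d)), (u x - u' x) ^ 2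
      ≤ ∫ x in (Ω : Set (Space d)), (w x * u x - w x * u' x - w' x * u x + w' x * u' x) := by
    refine integral_mono_ae hsq (((i1.sub i2).sub i3).add i4) ?_
    filter_upwards [hob, hob'] with x hx hx'
    obtain ⟨p1, p2, p3⟩ := obstacle_cases hx
    obtain ⟨q1, q2, q3⟩ := obstacle_cases hx'
    rcases p1.lt_or_eq with hlt | heq
    · have e := p3 hlt
      rcases q1.lt_or_eq with hlt' | heq'
      · have e' := q3 hlt'
        have : w x = w' x + u x - u' x := by linarith
        rw [this]
        nlinarith
      · rw [heq'] at q2 ⊢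
        nlinarith
    · rw [heq] at p2 ⊢
      rcases q1.lt_or_eq with hlt' | heq'
      · have e' := q3 hlt'
        nlinarith
      · rw [heq']
        simp
  rw [integral_sub_sub_add i1 i2 i3 i4, g1, g2, g3, g4] at hle
  have hzero : ∫ x in (Ω : Set (Space d)), (u x - u' x) ^ 2 = 0 :=
    le_antisymm (by linarith) (integral_nonneg fun x => sq_nonneg _)
  refine Lp.ext ?_
  filter_upwards [(integral_eq_zero_iff_of_nonneg (fun x => sq_nonneg _) hsq).1 hzero] with x hx
  exact sub_eq_zero.1 (pow_eq_zero_iff two_ne_zero |>.1 hx)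

end Uniqueness

end MixedMFG

/-! ### Uniqueness of mixed solutions -/

theorem mainTheorem2 {d : ℕ} (hd : 1 ≤ d)
    (Ω : TopologicalSpace.Opens (MixedMFG.Space d))
    (hΩ_bdd : Bornology.IsBounded (Ω : Set (MixedMFG.Space d)))
    (hΩ_C2 : MixedMFG.HasC2Boundary Ω)
    (ρ : 𝓓(Ω, ℝ)) (hρ : ∀ x, 0 ≤ ρ x)
    (f : MixedMFG.L2 Ω → MixedMFG.L2 Ω) (hf_cont : Continuous f)
    (hf : MixedMFG.StrictlyMonotone f)
    (u₁ m₁ u₂ m₂ : MixedMFG.L2 Ω)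
    (h₁ : MixedMFG.IsMixedSolution f ρ u₁ m₁)
    (h₂ : MixedMFG.IsMixedSolution f ρ u₂ m₂) :
    u₁ = u₂ ∧ m₁ = m₂ := by
  have hm : m₁ = m₂ := by
    by_contra hne
    have hpos := hf m₁ m₂ hne
    have a1 := h₁.integral_cost_le
    have a2 := h₂.integral_cost_le
    have b1 := h₁.le_integral_cost h₂
    have b2 := h₂.le_integral_cost h₁
    have i := fun u v : MixedMFG.L2 Ω => MixedMFG.integrable_mul_L2 u v
    have e : ∀ x, (f m₁ x - f m₂ x) * (m₁ x - m₂ x)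
        = f m₁ x * m₁ x - f m₁ x * m₂ x - f m₂ x * m₁ x + f m₂ x * m₂ x := fun x => by ring
    simp only [e] at hpos
    rw [MixedMFG.integral_sub_sub_add (i _ _) (i _ _) (i _ _) (i _ _)] at hpos
    linarith
  -- Both u₁ and u₂ now solve the obstacle problem with the same datum f(m₁).
  subst hm
  exact ⟨h₁.obstacle.unique h₂.obstacle h₁.u_memH10 h₂.u_memH10, rfl⟩
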